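/- Fix $\mu\in(0,1]$ and $\lambda>0$. Consider the Markov decision process with states $(a,z)$, $a\in\{1,2,\dots\}$ (age at the monitor), $z\in\{0,1,\dots\}$ (service received so far by the current update), and two actions: MEC ($u=1$) and local service ($u=0$). Under MEC the next state is $(1,0)$; under local service it is $(z+1,0)$ with probability $\mu$ and $(a+1,z+1)$ with probability $1-\mu$. The cost per slot is $C((a,z),u)=a+\tfrac12+\lambda u$. A policy $\pi=(\pi_n)_{n\ge0}$ is a sequence of maps from states to actions, with $U_n=\pi_n(S_n)$; its long-term average cost is $$V_\pi(s)=\limsup_{N\to\infty}\tfrac1N\,\mathbb E_\pi\Big[\sum_{n=1}^N C(S_n,U_n)\,\Big|\,S_0=s\Big],$$ and for $\beta\in(0,1)$ its $\beta$-discounted cost is $V_{\pi,\beta}(s)=\mathbb E_\pi\big[\sum_{n\ge0}\beta^nC(S_n,U_n)\mid S_0=s\big]$. A stationary policy is $\beta$-discount optimal if it attains $\inf_\pi V_{\pi,\beta}(s)$ for every $s$. By an optimal policy we mean a stationary deterministic policy $f$ for which there are a constant $g\in\mathbb R$ and a function $h$ on the states, bounded below, such that for every state $s$ $$g+h(s)=\min_{u}\Big(C(s,u)+\sum_{s'}P_{ss'}(u)h(s')\Big),\qquad\text{and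 } u=f(s)\text{ attains the minimum}.$$ Then: 1. There exist a sequence $\beta_k\in(0,1)$, $\beta_k\to1$, and $\beta_k$-discount optimal stationary policies that converge pointwise; and every pointwise limit of $\beta_k$-discount optimal stationary policies, for any such sequence $\beta_k\to1$, is an optimal policy. In particular optimal policies exist. 2. Every optimal policy $f$, with $g$ as above, has $V_f(s)=g\le V_\pi(s)$ for all states $s$ and all policies $\pi$; moreover (a) if $f$ uses the MEC in state $(a,z)$, then it uses the MEC in state $(a,z+1)$; (b) if $f$ uses local service in state $(a,z)$ with $z\ge1$, then it uses local service in state $(a,z-1)$; (c) the age thresholds $\bar a_z=\min\{a: f(a,z)=\mathrm{MEC}\}$ (with $\min\emptyset=\infty$) satisfy $\bar a_0\ge\bar a_1\ge\bar a_2\ge\cdots$. -/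

import Mathlib

noncomputable section

namespace MECOffload

/-- Use the local server (`u = 0`), or send a fresh update to the MEC (`u = 1`). -/
inductive Action where
  | loc : Action
  | mec : Action

/-- States `(a, z)`: the age `a ∈ {1, 2, …}` at the monitor and the amount of service
`z ∈ {0, 1, …}` that the current update has received. -/
abbrev State : Type := ℕ+ × ℕ

/-- The state just after an MEC service. -/
def freshState : State := (1, 0)

/-- A (stationary, deterministic) decision rule. -/
abbrev Rule : Type := State → Action

/-- A policy is a sequence of decision rules; rule `n` is applied in slot `n`. -/
abbrev Policy : Type := ℕ → Rule

/-- The stationary policy that applies `f` in every slot. -/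
def stationary (f : Rule) : Policy := fun _ => f

/-- `transition μ s u` is the next-state distribution (a finitely supported weight function)
from state `s` under action `u`. -/
def transition (μ : ℝ) (s : State) : Action → (State →₀ ℝ)
  | Action.mec => Finsupp.single freshState 1
  | Action.loc =>
      Finsupp.single (Nat.succPNat s.2, 0) μ + Finsupp.single (s.1 + 1, s.2 + 1) (1 - μ)

/-- `∑ t, p t * φ t`, the expectation of `φ` under the finitely supported weights `p`. -/
def expect (p : State →₀ ℝ) (φ : State → ℝ) : ℝ := p.sum fun t w => w * φ t

/-- The one-slot cost `a + 1/2 + lam * u`. -/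
def cost (lam : ℝ) (s : State) : Action → ℝ
  | Action.mec => ((s.1 : ℕ) : ℝ) + 1 / 2 + lam
  | Action.loc => ((s.1 : ℕ) : ℝ) + 1 / 2

/-- The distribution of `S n` under the policy `π`, given `S 0 = s`. -/
def law (μ : ℝ) (π : Policy) (s : State) : ℕ → (State →₀ ℝ)
  | 0 => Finsupp.single s 1
  | n + 1 => (law μ π s n).sum fun t w => w • transition μ t (π n t)

/-- The expected cost `E_π [C (S n, U n) | S 0 = s]` of slot `n`, where `U n = π n (S n)`. -/
def stageCost (μ lam : ℝ) (π : Policy) (s : State) (n : ℕ) : ℝ :=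
  expect (law μ π s n) fun t => cost lam t (π n t)

/-- The long-term average cost, the `limsup` of `(1/N) E_π [∑_{n=1}^N C (S n, U n) | S 0 = s]`. -/
def avgCost (μ lam : ℝ) (π : Policy) (s : State) : EReal :=
  Filter.limsup
    (fun N : ℕ =>
      ((1 / (N : ℝ) * ∑ n ∈ Finset.Icc 1 N, stageCost μ lam π s n : ℝ) : EReal))
    Filter.atTop

/-- `f`, used in every slot, minimizes the average cost over all policies,
from every initial state. -/
def IsAverageOptimal (μ lam : ℝ) (f : Rule) : Prop :=
  ∀ (π : Policy) (s : State), avgCost μ lam (stationary f) s ≤ avgCost μ lam π s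

/-- The total `β`-discounted cost. As the age grows by at most one per slot, the series
converges for `0 < β < 1`. -/
def discCost (μ lam β : ℝ) (π : Policy) (s : State) : ℝ :=
  ∑' n : ℕ, β ^ n * stageCost μ lam π s n

/-- The `β`-discounted value function. -/
def discValue (μ lam β : ℝ) (s : State) : ℝ := ⨅ π : Policy, discCost μ lam β π s

/-- `f`, used in every slot, attains the `β`-discounted value from every initial state. -/
def IsDiscountOptimal (μ lam β : ℝ) (f : Rule) : Prop :=
  ∀ s : State, discCost μ lam β (stationary f) s = discValue μ lam β s

/-- `f` is a pointwise limit of discount-optimal stationary policies, for some sequence of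
discount factors that tends to `1`. (The action set is finite and discrete, so that
convergence of actions means that they are eventually equal.) -/
def IsVanishingDiscountLimit (μ lam : ℝ) (f : Rule) : Prop :=
  ∃ (β : ℕ → ℝ) (F : ℕ → Rule),
    (∀ k, 0 < β k ∧ β k < 1) ∧
    Filter.Tendsto β Filter.atTop (nhds 1) ∧
    (∀ k, IsDiscountOptimal μ lam (β k) (F k)) ∧
    ∀ s, ∀ᶠ k in Filter.atTop, F k s = f s

/-- `C (s, u) + ∑ t, P_{s t}(u) h t`. -/
def bellman (μ lam : ℝ) (h : State → ℝ) (s : State) (u : Action) : ℝ :=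
  cost lam s u + expect (transition μ s u) h

/-- The constant `g` and the differential cost function `h`, bounded below, satisfy the
average cost optimality equation `g + h s = min_u (C (s, u) + ∑ t, P_{s t}(u) h t)`, and
`f` chooses an action that attains the minimum in every state. -/
def SolvesOptimalityEquation (μ lam : ℝ) (g : ℝ) (h : State → ℝ) (f : Rule) : Prop :=
  (∃ M : ℝ, ∀ s, -M ≤ h s) ∧
  (∀ s, g + h s = min (bellman μ lam h s Action.loc) (bellman μ lam h s Action.mec)) ∧
  ∀ s, g + h s = bellman μ lam h s (f s)

/-- The age threshold `min {a | f (a, z) = mec}`, which is `⊤` if there is no such age. -/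
def ageThreshold (f : Rule) (z : ℕ) : ℕ∞ :=
  ⨅ (a : ℕ+) (_ : f (a, z) = Action.mec), ((a : ℕ) : ℕ∞)

end MECOffload

end

/-! The average-cost equation is obtained by vanishing discount. MEC is always available, so a
discounted value exceeds its value in `freshState` by at most the age plus `1 / 2 + lam`.
Monotonicity of the value makes this difference nonnegative. The relative values therefore stay, for
each state, in a compact interval independent of `β`, and the discounted equations pass to the limit
(`IsVanishingDiscountLimit.exists_solvesOptimalityEquation`).

Conversely, any solution `h` that is bounded below differs from the age by a bounded amount. The
drift of `a + 2 * z` bounds its expectation uniformly in time, so summing the equation along a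
policy telescopes and identifies `g` as the optimal average cost.

The structure comes from `monotone_of_optimality_equation`: `h` grows by at least one per unit of
age and does not decrease in `z`. An extra unit of `z` thus makes local service strictly less
attractive relative to MEC, whose continuation cost is constant. Strictness settles ties, which is
why every optimal policy is covered. -/

namespace MECOffload

/-! ### Expectations under finitely supported laws -/

section Expectation

lemma expect_eq_linearCombination (p : State →₀ ℝ) (φ : State → ℝ) :
    expect p φ = Finsupp.linearCombination ℝ φ p := by
  simp [expect, Finsupp.linearCombination_apply]

lemma expect_single (s : State) (φ : State → ℝ) : expect (Finsupp.single s 1) φ = φ s := by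
  simp [expect_eq_linearCombination]

lemma expect_transition_mec (μ : ℝ) (s : State) (φ : State → ℝ) :
    expect (transition μ s Action.mec) φ = φ freshState := by
  simp [expect_eq_linearCombination, transition]

lemma expect_transition_loc (μ : ℝ) (s : State) (φ : State → ℝ) :
    expect (transition μ s Action.loc) φ =
      μ * φ (Nat.succPNat s.2, 0) + (1 - μ) * φ (s.1 + 1, s.2 + 1) := by
  simp [expect_eq_linearCombination, transition]
  ring

lemma expect_add (p : State →₀ ℝ) (φ ψ : State → ℝ) :
    expect p (fun t => φ t + ψ t) = expect p φ + expect p ψ := by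
  simp only [expect, Finsupp.sum, mul_add, Finset.sum_add_distrib]

lemma expect_const_mul (p : State →₀ ℝ) (c : ℝ) (φ : State → ℝ) :
    expect p (fun t => c * φ t) = c * expect p φ := by
  simp only [expect, Finsupp.sum, Finset.mul_sum, mul_left_comm]

variable {μ : ℝ}

lemma expect_transition_mono (hμ : 0 ≤ μ) (hμ' : μ ≤ 1) (s : State) (u : Action)
    {φ ψ : State → ℝ} (h : ∀ t, φ t ≤ ψ t) :
    expect (transition μ s u) φ ≤ expect (transition μ s u) ψ := by
  cases u
  · rw [expect_transition_loc, expect_transition_loc]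
    exact add_le_add (mul_le_mul_of_nonneg_left (h _) hμ)
      (mul_le_mul_of_nonneg_left (h _) (sub_nonneg.2 hμ'))
  · rw [expect_transition_mec, expect_transition_mec]
    exact h _

lemma expect_transition_const (μ : ℝ) (s : State) (u : Action) (c : ℝ) :
    expect (transition μ s u) (fun _ => c) = c := by
  cases u
  · rw [expect_transition_loc]; ring
  · rw [expect_transition_mec]

lemma expect_law_zero (μ : ℝ) (π : Policy) (s : State) (φ : State → ℝ) :
    expect (law μ π s 0) φ = φ s := expect_single s φ

lemma expect_law_succ (μ : ℝ) (π : Policy) (s : State) (n : ℕ) (φ : State → ℝ) :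
    expect (law μ π s (n + 1)) φ =
      expect (law μ π s n) fun t => expect (transition μ t (π n t)) φ := by
  simp only [law, expect_eq_linearCombination, map_finsuppSum, map_smul]
  simp [Finsupp.linearCombination_apply]

/-- Conditioning on the first slot instead of the last; the discounted recursion needs this form. -/
lemma expect_law_succ' (μ : ℝ) (π : Policy) (s : State) (n : ℕ) (φ : State → ℝ) :
    expect (law μ π s (n + 1)) φ =
      expect (transition μ s (π 0 s)) fun t => expect (law μ (fun k => π (k + 1)) t n) φ := by
  induction n generalizing φ with
  | zero =>
    rw [expect_law_succ, expect_law_zero]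
    simp only [expect_law_zero]
  | succ n ih =>
    rw [expect_law_succ, ih]
    simp only [expect_law_succ μ (fun k => π (k + 1))]

lemma expect_law_const (μ : ℝ) (π : Policy) (s : State) (n : ℕ) (c : ℝ) :
    expect (law μ π s n) (fun _ => c) = c := by
  induction n with
  | zero => rw [expect_law_zero]
  | succ n ih => simp only [expect_law_succ, expect_transition_const, ih]

lemma expect_law_mono (hμ : 0 ≤ μ) (hμ' : μ ≤ 1) (π : Policy) (s : State) (n : ℕ)
    {φ ψ : State → ℝ} (h : ∀ t, φ t ≤ ψ t) :
    expect (law μ π s n) φ ≤ expect (law μ π s n) ψ := by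
  induction n generalizing φ ψ with
  | zero => simpa only [expect_law_zero] using h s
  | succ n ih =>
    rw [expect_law_succ, expect_law_succ]
    exact ih fun t => expect_transition_mono hμ hμ' t _ h

end Expectation

/-! ### Uniform moment bounds -/

section Lyapunov

/-- A Lyapunov function for the chain under every policy. -/
def lyap (s : State) : ℝ := ((s.1 : ℕ) : ℝ) + 2 * (s.2 : ℝ)

lemma one_le_age (a : ℕ+) : (1 : ℝ) ≤ ((a : ℕ) : ℝ) := by exact_mod_cast a.pos

lemma lyap_nonneg (s : State) : 0 ≤ lyap s := by
  unfold lyap; positivity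

lemma age_le_lyap (s : State) : ((s.1 : ℕ) : ℝ) ≤ lyap s := by
  unfold lyap; linarith [Nat.cast_nonneg (α := ℝ) s.2]

variable {μ : ℝ}

/-- A completed local service turns `z` into age. Weight 2 on `z` makes this a loss: its coefficient
drops from `2` to `μ + 2 * (1 - μ) = 2 - μ`, whereas weight 1 would give no contraction. -/
lemma expect_transition_lyap_le (hμ : 0 < μ) (hμ' : μ ≤ 1) (s : State) (u : Action) :
    expect (transition μ s u) lyap ≤ (1 - μ / 2) * lyap s + 3 := by
  cases u
  · rw [expect_transition_loc]
    have h1 := one_le_age s.1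
    simp only [lyap, Nat.succPNat_coe, PNat.add_coe, PNat.one_coe, Nat.succ_eq_add_one]
    push_cast
    nlinarith
  · rw [expect_transition_mec]
    have h := lyap_nonneg s
    have : lyap freshState = 1 := by simp [lyap, freshState]
    rw [this]
    nlinarith

lemma expect_law_lyap_le (hμ : 0 < μ) (hμ' : μ ≤ 1) (π : Policy) (s : State) (n : ℕ) :
    expect (law μ π s n) lyap ≤ lyap s + 6 / μ := by
  induction n with
  | zero =>
    rw [expect_law_zero]
    have : 0 < 6 / μ := by positivity
    linarith
  | succ n ih =>
    rw [expect_law_succ]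
    have h1 := expect_law_mono hμ.le hμ' π s n
      (fun t => expect_transition_lyap_le hμ hμ' t (π n t))
    rw [expect_add, expect_const_mul, expect_law_const] at h1
    have h2 : (1 - μ / 2) * expect (law μ π s n) lyap ≤ (1 - μ / 2) * (lyap s + 6 / μ) :=
      mul_le_mul_of_nonneg_left ih (by linarith)
    -- `6 / μ` is the fixed point of `x ↦ (1 - μ / 2) * x + 3`.
    have h3 : μ / 2 * (6 / μ) = 3 := by field_simp; norm_num
    have h4 : 0 ≤ μ / 2 * lyap s := mul_nonneg (by linarith) (lyap_nonneg s)
    linarith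

lemma abs_expect_law_le (hμ : 0 < μ) (hμ' : μ ≤ 1) {φ : State → ℝ} {K : ℝ}
    (hφ : ∀ t, |φ t| ≤ lyap t + K) (π : Policy) (s : State) (n : ℕ) :
    |expect (law μ π s n) φ| ≤ lyap s + 6 / μ + K := by
  have hW := expect_law_lyap_le hμ hμ' π s n
  have h1 := expect_law_mono hμ.le hμ' π s n (fun t => (abs_le.1 (hφ t)).2)
  have h2 := expect_law_mono hμ.le hμ' π s n (φ := fun t => (-1) * (lyap t + K)) (ψ := φ)
    (fun t => by linarith [(abs_le.1 (hφ t)).1])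
  rw [expect_const_mul] at h2
  rw [expect_add, expect_law_const] at h1 h2
  rw [abs_le]
  constructor <;> linarith

end Lyapunov

/-! ### Bounds and recursion for the slot costs -/

section Cost

variable {μ lam : ℝ}

lemma cost_nonneg (hlam : 0 ≤ lam) (s : State) (u : Action) : 0 ≤ cost lam s u := by
  cases u <;> simp only [cost] <;> positivity

lemma age_le_cost (hlam : 0 ≤ lam) (s : State) (u : Action) :
    ((s.1 : ℕ) : ℝ) ≤ cost lam s u := by
  cases u <;> simp only [cost] <;> linarith

lemma cost_le (hlam : 0 ≤ lam) (s : State) (u : Action) :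
    cost lam s u ≤ lyap s + (1 / 2 + lam) := by
  have := age_le_lyap s
  cases u <;> simp only [cost] <;> linarith

lemma stageCost_zero (μ lam : ℝ) (π : Policy) (s : State) :
    stageCost μ lam π s 0 = cost lam s (π 0 s) := expect_law_zero _ _ _ _

lemma stageCost_succ (μ lam : ℝ) (π : Policy) (s : State) (n : ℕ) :
    stageCost μ lam π s (n + 1) =
      expect (transition μ s (π 0 s)) fun t => stageCost μ lam (fun k => π (k + 1)) t n :=
  expect_law_succ' _ _ _ _ _

lemma stageCost_nonneg (hμ : 0 < μ) (hμ' : μ ≤ 1) (hlam : 0 ≤ lam) (π : Policy) (s : State)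
    (n : ℕ) : 0 ≤ stageCost μ lam π s n := by
  have h := expect_law_mono hμ.le hμ' π s n (fun t => cost_nonneg hlam t (π n t))
  rwa [expect_law_const] at h

lemma stageCost_le (hμ : 0 < μ) (hμ' : μ ≤ 1) (hlam : 0 ≤ lam) (π : Policy) (s : State)
    (n : ℕ) : stageCost μ lam π s n ≤ lyap s + 6 / μ + (1 / 2 + lam) :=
  (abs_le.1 (abs_expect_law_le hμ hμ' (fun t => by
    rw [abs_of_nonneg (cost_nonneg hlam t (π n t))]
    exact cost_le hlam t _) π s n)).2

end Cost

/-! ### Monotonicity of solutions -/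

section Monotone

/-- A solution of a (discounted or undiscounted) optimality equation that differs from the age by
a bounded amount is monotone, and increases by at least one with every unit of age. -/
lemma monotone_of_optimality_equation {μ β A g K : ℝ} (hμ : 0 < μ) (hμ' : μ ≤ 1) (hβ : 0 ≤ β)
    (hβ' : β ≤ 1) {v : State → ℝ} (hK : ∀ s : State, |v s - ((s.1 : ℕ) : ℝ)| ≤ K)
    (hv : ∀ (a : ℕ+) (z : ℕ), g + v (a, z) = ((a : ℕ) : ℝ) + 1 / 2 +
      min A (β * (μ * v (Nat.succPNat z, 0) + (1 - μ) * v (a + 1, z + 1)))) :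
    (∀ (a : ℕ+) (z : ℕ), v (a, z) + 1 ≤ v (a + 1, z)) ∧
      ∀ (a : ℕ+) (z : ℕ), v (a, z) ≤ v (a, z + 1) := by
  -- The cap `A` can absorb a gain but never worsens a loss, so only nonpositive increments pass
  -- through the minimum.
  have hmin : ∀ x y d : ℝ, x + d ≤ y → d ≤ 0 → min A x + d ≤ min A y := fun x y d h hd =>
    le_min (by linarith [min_le_left A x]) (by linarith [min_le_right A x])
  have hc0 : 0 ≤ β * (1 - μ) := mul_nonneg hβ (by linarith)
  have hc1 : β * (1 - μ) < 1 := by nlinarith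
  have hage : ∀ a : ℕ+, (((a + 1 : ℕ+) : ℕ) : ℝ) = ((a : ℕ) : ℝ) + 1 := fun a => by simp
  have step1 : ∀ (a : ℕ+) (z : ℕ), v (a, z) + 1 ≤ v (a + 1, z) := by
    let d : State → ℝ := fun s => v (s.1 + 1, s.2) - v s
    have hbdd : BddBelow (Set.range d) := by
      refine ⟨1 - 2 * K, ?_⟩
      rintro _ ⟨s, rfl⟩
      have h1 := (abs_le.1 (hK (s.1 + 1, s.2))).1
      have h2 := (abs_le.1 (hK s)).2
      have h3 := hage s.1
      simp only [d] at *
      linarith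
    have hD : ∀ s, (⨅ t, d t) ≤ d s := fun s => ciInf_le hbdd s
    have hstep : ∀ e : ℝ, e ≤ 0 → (∀ s, e ≤ d s) →
        ∀ s, 1 + β * (1 - μ) * e ≤ d s := by
      rintro e he hde ⟨a, z⟩
      have h1 := hv a z
      have h2 := hv (a + 1) z
      have h3 := hde (a + 1, z + 1)
      simp only [d] at h3 ⊢
      have h4 := hmin (β * (μ * v (Nat.succPNat z, 0) + (1 - μ) * v (a + 1, z + 1)))
        (β * (μ * v (Nat.succPNat z, 0) + (1 - μ) * v (a + 1 + 1, z + 1))) (β * (1 - μ) * e)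
        (by linarith [mul_le_mul_of_nonneg_left h3 hc0]) (mul_nonpos_of_nonneg_of_nonpos hc0 he)
      linarith [hage a]
    -- A negative infimum `D` would satisfy `1 + β * (1 - μ) * D ≤ D`, impossible since `β * (1 - μ)
    -- < 1`. Feeding the bound `0` back into `hstep` then gives increments of at least `1`.
    have hD0 : 0 ≤ ⨅ t, d t := by
      by_contra! hneg
      have := le_ciInf (hstep _ hneg.le hD)
      nlinarith
    intro a z
    have := hstep 0 le_rfl (fun s => hD0.trans (hD s)) (a, z)
    simp only [d] at this
    linarith
  refine ⟨step1, ?_⟩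
  let d : State → ℝ := fun s => v (s.1, s.2 + 1) - v s
  have hbdd : BddBelow (Set.range d) := by
    refine ⟨- 2 * K, ?_⟩
    rintro _ ⟨s, rfl⟩
    have h1 := (abs_le.1 (hK (s.1, s.2 + 1))).1
    have h2 := (abs_le.1 (hK s)).2
    simp only [d] at *
    linarith
  have hD : ∀ s, (⨅ t, d t) ≤ d s := fun s => ciInf_le hbdd s
  have hD0 : 0 ≤ ⨅ t, d t := by
    by_contra! hneg
    have : β * (1 - μ) * (⨅ t, d t) ≤ ⨅ t, d t := by
      refine le_ciInf ?_
      rintro ⟨a, z⟩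
      have h1 := hv a z
      have h2 := hv a (z + 1)
      have h3 := hD (a + 1, z + 1)
      -- Completion with one more unit of service leaves an age larger by one, so the age
      -- monotonicity applies.
      have h5 : v (Nat.succPNat z, 0) + 1 ≤ v (Nat.succPNat (z + 1), 0) :=
        step1 (Nat.succPNat z) 0
      simp only [d] at h3 ⊢
      have h6 : 0 ≤ β * μ := mul_nonneg hβ hμ.le
      have h4 := hmin (β * (μ * v (Nat.succPNat z, 0) + (1 - μ) * v (a + 1, z + 1)))
        (β * (μ * v (Nat.succPNat (z + 1), 0) + (1 - μ) * v (a + 1, z + 1 + 1)))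
        (β * (1 - μ) * (⨅ t, d t))
        (by linarith [mul_le_mul_of_nonneg_left h3 hc0, mul_le_mul_of_nonneg_left h5 h6])
        (mul_nonpos_of_nonneg_of_nonpos hc0 hneg.le)
      simp only [d] at h4
      linarith
    nlinarith
  intro a z
  have := hD0.trans (hD (a, z))
  simp only [d] at this
  linarith

lemma apply_freshState_le {v : State → ℝ} (ha : ∀ (a : ℕ+) (z : ℕ), v (a, z) ≤ v (a + 1, z))
    (hz : ∀ (a : ℕ+) (z : ℕ), v (a, z) ≤ v (a, z + 1)) (s : State) : v freshState ≤ v s := by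
  obtain ⟨a, z⟩ := s
  have h1 : v (1, 0) ≤ v (a, 0) := by
    induction a using PNat.recOn with
    | one => exact le_rfl
    | succ a ih => exact ih.trans (ha a 0)
  exact h1.trans (monotone_nat_of_le_succ (f := fun z => v (a, z)) (hz a) (Nat.zero_le z))

end Monotone

/-! ### Verification and structure for the average-cost equation -/

section AverageCost

variable {μ lam g : ℝ} {h : State → ℝ} {f : Rule}

lemma bellman_mec (μ lam : ℝ) (h : State → ℝ) (s : State) :
    bellman μ lam h s Action.mec = ((s.1 : ℕ) : ℝ) + 1 / 2 + (lam + h freshState) := by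
  rw [bellman, expect_transition_mec, cost]; ring

lemma bellman_loc (μ lam : ℝ) (h : State → ℝ) (s : State) :
    bellman μ lam h s Action.loc = ((s.1 : ℕ) : ℝ) + 1 / 2 +
      (μ * h (Nat.succPNat s.2, 0) + (1 - μ) * h (s.1 + 1, s.2 + 1)) := by
  rw [bellman, expect_transition_loc, cost]

lemma SolvesOptimalityEquation.le_bellman (H : SolvesOptimalityEquation μ lam g h f) (s : State)
    (u : Action) : g + h s ≤ bellman μ lam h s u := by
  rw [H.2.1 s]
  cases u
  · exact min_le_left _ _
  · exact min_le_right _ _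

lemma SolvesOptimalityEquation.eq_age_add_min (H : SolvesOptimalityEquation μ lam g h f)
    (a : ℕ+) (z : ℕ) : g + h (a, z) = ((a : ℕ) : ℝ) + 1 / 2 + min (lam + h freshState)
      (1 * (μ * h (Nat.succPNat z, 0) + (1 - μ) * h (a + 1, z + 1))) := by
  rw [H.2.1, bellman_mec, bellman_loc, one_mul, min_add_add_left, min_comm]

lemma SolvesOptimalityEquation.exists_abs_sub_age_le (hμ : 0 ≤ μ) (hμ' : μ ≤ 1)
    (H : SolvesOptimalityEquation μ lam g h f) :
    ∃ K, ∀ s : State, |h s - ((s.1 : ℕ) : ℝ)| ≤ K := by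
  obtain ⟨M, hM⟩ := H.1
  -- The MEC branch gives the upper bound; inserting `-M` for `h` in the local branch gives the
  -- lower one.
  refine ⟨max (1 / 2 + lam + h freshState - g) (g - 1 / 2 - min (lam + h freshState) (-M)), ?_⟩
  rintro ⟨a, z⟩
  have h1 := H.eq_age_add_min a z
  have h2 : -M ≤ 1 * (μ * h (Nat.succPNat z, 0) + (1 - μ) * h (a + 1, z + 1)) := by
    have h3 := mul_le_mul_of_nonneg_left (hM (Nat.succPNat z, 0)) hμ
    have h4 := mul_le_mul_of_nonneg_left (hM (a + 1, z + 1)) (sub_nonneg.2 hμ')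
    linarith
  have h5 := min_le_min_left (lam + h freshState) h2
  have h6 := min_le_left (lam + h freshState)
    (1 * (μ * h (Nat.succPNat z, 0) + (1 - μ) * h (a + 1, z + 1)))
  rw [abs_le]
  constructor
  · have := le_max_right (1 / 2 + lam + h freshState - g)
      (g - 1 / 2 - min (lam + h freshState) (-M))
    simp only
    linarith
  · have := le_max_left (1 / 2 + lam + h freshState - g)
      (g - 1 / 2 - min (lam + h freshState) (-M))
    simp only
    linarith

lemma sum_Icc_succ_sub (u : ℕ → ℝ) (g : ℝ) (N : ℕ) :
    ∑ n ∈ Finset.Icc 1 N, (g + u n - u (n + 1)) = N * g + u 1 - u (N + 1) := by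
  induction N with
  | zero => simp
  | succ N ih =>
    rw [Finset.sum_Icc_succ_top (by omega), ih]
    push_cast
    ring

lemma tendsto_const_add_div (g c : ℝ) :
    Filter.Tendsto (fun N : ℕ => ((g + c / N : ℝ) : EReal)) Filter.atTop (nhds (g : EReal)) := by
  have : Filter.Tendsto (fun N : ℕ => g + c / (N : ℝ)) Filter.atTop (nhds (g + 0)) :=
    tendsto_const_nhds.add (tendsto_const_div_atTop_nhds_zero_nat c)
  rw [add_zero] at this
  exact (continuous_coe_real_ereal.tendsto g).comp this

lemma expect_law_add_sub (π : Policy) (s : State) (n : ℕ) :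
    expect (law μ π s n) (fun t => g + h t + (-1) * expect (transition μ t (π n t)) h) =
      g + expect (law μ π s n) h - expect (law μ π s (n + 1)) h := by
  rw [expect_add, expect_add, expect_law_const, expect_const_mul, expect_law_succ]
  ring

lemma SolvesOptimalityEquation.exists_abs_expect_law_le (hμ : 0 < μ) (hμ' : μ ≤ 1)
    (H : SolvesOptimalityEquation μ lam g h f) (s : State) :
    ∃ B, ∀ (π : Policy) (n : ℕ), |expect (law μ π s n) h| ≤ B := by
  obtain ⟨K, hK⟩ := H.exists_abs_sub_age_le hμ.le hμ'
  refine ⟨_, fun π n => abs_expect_law_le hμ hμ' (K := K) (fun t => ?_) π s n⟩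
  have h1 := age_le_lyap t
  have h2 := abs_le.1 (hK t)
  have h3 := one_le_age t.1
  rw [abs_le]
  constructor <;> linarith

lemma SolvesOptimalityEquation.le_avgCost (hμ : 0 < μ) (hμ' : μ ≤ 1)
    (H : SolvesOptimalityEquation μ lam g h f) (π : Policy) (s : State) :
    (g : EReal) ≤ avgCost μ lam π s := by
  obtain ⟨B, hB⟩ := H.exists_abs_expect_law_le hμ hμ' s
  rw [← (tendsto_const_add_div g (-(2 * B))).limsup_eq]
  refine Filter.limsup_le_limsup ?_
  filter_upwards [Filter.eventually_gt_atTop 0] with N hN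
  rw [EReal.coe_le_coe_iff]
  have hN' : (0 : ℝ) < N := by exact_mod_cast hN
  have hsum : ∑ n ∈ Finset.Icc 1 N,
      (g + expect (law μ π s n) h - expect (law μ π s (n + 1)) h) ≤
        ∑ n ∈ Finset.Icc 1 N, stageCost μ lam π s n := by
    refine Finset.sum_le_sum fun n _ => ?_
    rw [← expect_law_add_sub]
    refine expect_law_mono hμ.le hμ' π s n fun t => ?_
    have := H.le_bellman t (π n t)
    rw [bellman] at this
    linarith
  rw [sum_Icc_succ_sub (fun n => expect (law μ π s n) h)] at hsum
  have h1 := (abs_le.1 (hB π 1)).1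
  have h2 := (abs_le.1 (hB π (N + 1))).2
  rw [one_div, inv_mul_eq_div, le_div_iff₀ hN', add_mul, div_mul_cancel₀ _ hN'.ne']
  linarith

lemma SolvesOptimalityEquation.avgCost_stationary_le (hμ : 0 < μ) (hμ' : μ ≤ 1)
    (H : SolvesOptimalityEquation μ lam g h f) (s : State) :
    avgCost μ lam (stationary f) s ≤ g := by
  obtain ⟨B, hB⟩ := H.exists_abs_expect_law_le hμ hμ' s
  rw [← (tendsto_const_add_div g (2 * B)).limsup_eq]
  refine Filter.limsup_le_limsup ?_
  filter_upwards [Filter.eventually_gt_atTop 0] with N hN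
  rw [EReal.coe_le_coe_iff]
  have hN' : (0 : ℝ) < N := by exact_mod_cast hN
  have hsum : ∑ n ∈ Finset.Icc 1 N, stageCost μ lam (stationary f) s n =
      ∑ n ∈ Finset.Icc 1 N, (g + expect (law μ (stationary f) s n) h -
        expect (law μ (stationary f) s (n + 1)) h) := by
    refine Finset.sum_congr rfl fun n _ => ?_
    rw [← expect_law_add_sub, stageCost]
    congr 1
    funext t
    have := H.2.2 t
    rw [bellman] at this
    simp only [stationary]
    linarith
  rw [sum_Icc_succ_sub (fun n => expect (law μ (stationary f) s n) h)] at hsum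
  have h1 := (abs_le.1 (hB (stationary f) 1)).2
  have h2 := (abs_le.1 (hB (stationary f) (N + 1))).1
  rw [one_div, inv_mul_eq_div, div_le_iff₀ hN', add_mul, div_mul_cancel₀ _ hN'.ne']
  linarith

/-- From `z` to `z + 1` the local continuation cost rises by at least `μ > 0`, while that of MEC is
unchanged. If MEC attains the minimum at `z`, it is the only minimizer at `z + 1`. -/
lemma SolvesOptimalityEquation.mec_succ (hμ : 0 < μ) (hμ' : μ ≤ 1)
    (H : SolvesOptimalityEquation μ lam g h f) (a : ℕ+) (z : ℕ) (hf : f (a, z) = Action.mec) :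
    f (a, z + 1) = Action.mec := by
  obtain ⟨K, hK⟩ := H.exists_abs_sub_age_le hμ.le hμ'
  obtain ⟨hage, hserv⟩ := monotone_of_optimality_equation hμ hμ' zero_le_one le_rfl hK
    H.eq_age_add_min
  cases hf' : f (a, z + 1) with
  | mec => rfl
  | loc =>
    exfalso
    have h1 := H.2.2 (a, z)
    have h2 := H.le_bellman (a, z) Action.loc
    have h3 := H.2.2 (a, z + 1)
    have h4 := H.le_bellman (a, z + 1) Action.mec
    rw [hf] at h1
    rw [hf'] at h3
    rw [bellman_mec] at h1 h4
    rw [bellman_loc] at h2 h3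
    have h5 : h (Nat.succPNat z, 0) + 1 ≤ h (Nat.succPNat (z + 1), 0) :=
      hage (Nat.succPNat z) 0
    have h6 := mul_le_mul_of_nonneg_left h5 hμ.le
    have h7 := mul_le_mul_of_nonneg_left (hserv (a + 1) (z + 1)) (sub_nonneg.2 hμ')
    simp only at h1 h2 h3 h4
    linarith

lemma antitone_ageThreshold
    (hf : ∀ (a : ℕ+) (z : ℕ), f (a, z) = Action.mec → f (a, z + 1) = Action.mec) :
    Antitone (ageThreshold f) :=
  antitone_nat_of_succ_le fun z => le_iInf₂ fun a ha => iInf₂_le a (hf a z ha)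

end AverageCost

/-! ### The discounted problem -/

section Discount

variable {μ lam β : ℝ}

lemma summable_discCost (hμ : 0 < μ) (hμ' : μ ≤ 1) (hlam : 0 ≤ lam) (hβ : 0 < β) (hβ' : β < 1)
    (π : Policy) (s : State) : Summable fun n : ℕ => β ^ n * stageCost μ lam π s n := by
  refine Summable.of_nonneg_of_le
    (fun n => mul_nonneg (pow_nonneg hβ.le n) (stageCost_nonneg hμ hμ' hlam π s n))
    (fun n => mul_le_mul_of_nonneg_left (stageCost_le hμ hμ' hlam π s n) (pow_nonneg hβ.le n))
    ((summable_geometric_of_lt_one hβ.le hβ').mul_right _)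

lemma discCost_nonneg (hμ : 0 < μ) (hμ' : μ ≤ 1) (hlam : 0 ≤ lam) (hβ : 0 < β)
    (π : Policy) (s : State) : 0 ≤ discCost μ lam β π s :=
  tsum_nonneg fun n => mul_nonneg (pow_nonneg hβ.le n) (stageCost_nonneg hμ hμ' hlam π s n)

lemma discValue_le (hμ : 0 < μ) (hμ' : μ ≤ 1) (hlam : 0 ≤ lam) (hβ : 0 < β)
    (π : Policy) (s : State) : discValue μ lam β s ≤ discCost μ lam β π s :=
  ciInf_le ⟨0, by rintro _ ⟨π, rfl⟩; exact discCost_nonneg hμ hμ' hlam hβ π s⟩ π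

lemma discValue_nonneg (hμ : 0 < μ) (hμ' : μ ≤ 1) (hlam : 0 ≤ lam) (hβ : 0 < β) (s : State) :
    0 ≤ discValue μ lam β s :=
  have : Nonempty Policy := ⟨fun _ _ => Action.loc⟩
  le_ciInf fun π => discCost_nonneg hμ hμ' hlam hβ π s

/-- One-slot decomposition of the discounted cost. -/
lemma discCost_eq (hμ : 0 < μ) (hμ' : μ ≤ 1) (hlam : 0 ≤ lam) (hβ : 0 < β) (hβ' : β < 1)
    (π : Policy) (s : State) :
    discCost μ lam β π s = cost lam s (π 0 s) +
      β * expect (transition μ s (π 0 s)) (discCost μ lam β fun k => π (k + 1)) := by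
  have hS := summable_discCost hμ hμ' hlam hβ hβ' (fun k => π (k + 1))
  rw [discCost, (summable_discCost hμ hμ' hlam hβ hβ' π s).tsum_eq_zero_add, pow_zero, one_mul,
    stageCost_zero]
  congr 1
  simp only [stageCost_succ, pow_succ']
  cases π 0 s
  · simp only [expect_transition_loc, discCost]
    rw [← tsum_mul_left (a := μ), ← tsum_mul_left (a := 1 - μ),
      ← ((hS _).mul_left _).tsum_add ((hS _).mul_left _), ← tsum_mul_left]
    exact tsum_congr fun n => by ring
  · simp only [expect_transition_mec, discCost]
    rw [← tsum_mul_left]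
    exact tsum_congr fun n => by ring

/-- The right-hand side of the `β`-discounted optimality equation, for the action `u`. -/
noncomputable def discBellman (μ lam β : ℝ) (v : State → ℝ) (s : State) (u : Action) : ℝ :=
  cost lam s u + β * expect (transition μ s u) v

lemma discBellman_le_discCost (hμ : 0 < μ) (hμ' : μ ≤ 1) (hlam : 0 ≤ lam) (hβ : 0 < β)
    (hβ' : β < 1) (π : Policy) (s : State) :
    discBellman μ lam β (discValue μ lam β) s (π 0 s) ≤ discCost μ lam β π s := by
  rw [discCost_eq hμ hμ' hlam hβ hβ', discBellman]
  gcongr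
  exact expect_transition_mono hμ.le hμ' s _ fun t => discValue_le hμ hμ' hlam hβ _ t

/-- Iterating the inequality bounds every finite-horizon cost by `v`; the terminal term is dropped
because `v` is nonnegative. -/
lemma discCost_stationary_le (hμ : 0 < μ) (hμ' : μ ≤ 1) (hlam : 0 ≤ lam) (hβ : 0 < β)
    {v : State → ℝ} {f : Rule} (hv0 : ∀ s, 0 ≤ v s)
    (hv : ∀ s, discBellman μ lam β v s (f s) ≤ v s) (s : State) :
    discCost μ lam β (stationary f) s ≤ v s := by
  refine Real.tsum_le_of_sum_range_le (fun n => mul_nonneg (pow_nonneg hβ.le n)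
    (stageCost_nonneg hμ hμ' hlam _ s n)) fun N => ?_
  induction N generalizing s with
  | zero => simpa using hv0 s
  | succ N ih =>
    refine le_trans (le_of_eq ?_) ((add_le_add_right (mul_le_mul_of_nonneg_left
      (expect_transition_mono hμ.le hμ' s (f s) ih) hβ.le) (cost lam s (f s))).trans (hv s))
    rw [Finset.sum_range_succ', pow_zero, one_mul, stageCost_zero, add_comm]
    have hsucc : ∀ n, stageCost μ lam (stationary f) s (n + 1) =
        expect (transition μ s (f s)) fun t => stageCost μ lam (stationary f) t n :=
      stageCost_succ μ lam (stationary f) s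
    congr 1
    simp only [hsucc, pow_succ', expect, Finsupp.sum, Finset.mul_sum]
    rw [Finset.sum_comm]
    exact Finset.sum_congr rfl fun t _ => Finset.sum_congr rfl fun n _ => by ring

/-- A rule that is greedy with respect to the discounted value function. -/
lemma exists_greedy (v : State → ℝ) :
    ∃ f : Rule, ∀ s u, discBellman μ lam β v s (f s) ≤ discBellman μ lam β v s u := by
  have : ∀ s, ∃ w, ∀ u, discBellman μ lam β v s w ≤ discBellman μ lam β v s u := by
    intro s
    rcases le_total (discBellman μ lam β v s Action.loc) (discBellman μ lam β v s Action.mec)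
      with h | h
    · exact ⟨Action.loc, fun u => by cases u; exacts [le_rfl, h]⟩
    · exact ⟨Action.mec, fun u => by cases u; exacts [h, le_rfl]⟩
  exact ⟨fun s => (this s).choose, fun s => (this s).choose_spec⟩

/-- The greedy one-step cost is below the cost of each policy, hence below their infimum, so the
value function is a supersolution for the greedy rule. -/
lemma isDiscountOptimal_of_greedy (hμ : 0 < μ) (hμ' : μ ≤ 1) (hlam : 0 ≤ lam) (hβ : 0 < β)
    (hβ' : β < 1) {f : Rule}
    (hf : ∀ s u, discBellman μ lam β (discValue μ lam β) s (f s) ≤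
      discBellman μ lam β (discValue μ lam β) s u) : IsDiscountOptimal μ lam β f := by
  have : Nonempty Policy := ⟨fun _ _ => Action.loc⟩
  exact fun s => le_antisymm
    (discCost_stationary_le hμ hμ' hlam hβ (discValue_nonneg hμ hμ' hlam hβ)
      (fun t => le_ciInf fun π =>
        (hf t _).trans (discBellman_le_discCost hμ hμ' hlam hβ hβ' π t)) s)
    (discValue_le hμ hμ' hlam hβ _ s)

lemma exists_isDiscountOptimal (hμ : 0 < μ) (hμ' : μ ≤ 1) (hlam : 0 ≤ lam) (hβ : 0 < β)
    (hβ' : β < 1) : ∃ f, IsDiscountOptimal μ lam β f :=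
  let ⟨f, hf⟩ := exists_greedy (discValue μ lam β)
  ⟨f, isDiscountOptimal_of_greedy hμ hμ' hlam hβ hβ' hf⟩

lemma IsDiscountOptimal.discValue_eq {f : Rule} (hf : IsDiscountOptimal μ lam β f) (hμ : 0 < μ)
    (hμ' : μ ≤ 1) (hlam : 0 ≤ lam) (hβ : 0 < β) (hβ' : β < 1) (s : State) :
    discValue μ lam β s = discBellman μ lam β (discValue μ lam β) s (f s) := by
  have h := discCost_eq hμ hμ' hlam hβ hβ' (stationary f) s
  have hv : discCost μ lam β (stationary f) = discValue μ lam β := funext hf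
  rw [← hv]
  exact h

lemma discValue_le_discBellman (hμ : 0 < μ) (hμ' : μ ≤ 1) (hlam : 0 ≤ lam) (hβ : 0 < β)
    (hβ' : β < 1) (s : State) (u : Action) :
    discValue μ lam β s ≤ discBellman μ lam β (discValue μ lam β) s u := by
  obtain ⟨f, hf⟩ := exists_greedy (μ := μ) (lam := lam) (β := β) (discValue μ lam β)
  rw [(isDiscountOptimal_of_greedy hμ hμ' hlam hβ hβ' hf).discValue_eq hμ hμ' hlam hβ hβ' s]
  exact hf s u

lemma discValue_eq_min (hμ : 0 < μ) (hμ' : μ ≤ 1) (hlam : 0 ≤ lam) (hβ : 0 < β) (hβ' : β < 1)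
    (s : State) : discValue μ lam β s =
      min (discBellman μ lam β (discValue μ lam β) s Action.loc)
        (discBellman μ lam β (discValue μ lam β) s Action.mec) := by
  obtain ⟨f, hf⟩ := exists_isDiscountOptimal hμ hμ' hlam hβ hβ'
  refine le_antisymm (le_min (discValue_le_discBellman hμ hμ' hlam hβ hβ' s _)
    (discValue_le_discBellman hμ hμ' hlam hβ hβ' s _)) ?_
  rw [hf.discValue_eq hμ hμ' hlam hβ hβ' s]
  cases f s
  · exact min_le_left _ _
  · exact min_le_right _ _

lemma discValue_le_age_add (hμ : 0 < μ) (hμ' : μ ≤ 1) (hlam : 0 ≤ lam) (hβ : 0 < β)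
    (hβ' : β < 1) (s : State) : discValue μ lam β s ≤
      ((s.1 : ℕ) : ℝ) + 1 / 2 + lam + β * discValue μ lam β freshState := by
  have h := discValue_le_discBellman hμ hμ' hlam hβ hβ' s Action.mec
  rwa [discBellman, expect_transition_mec, cost] at h

lemma discValue_freshState_le (hμ : 0 < μ) (hμ' : μ ≤ 1) (hlam : 0 ≤ lam) (hβ : 0 < β)
    (hβ' : β < 1) (s : State) : discValue μ lam β freshState ≤ discValue μ lam β s := by
  have hK : ∀ s : State, |discValue μ lam β s - ((s.1 : ℕ) : ℝ)| ≤
      1 / 2 + lam + β * discValue μ lam β freshState := by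
    intro s
    have h1 := discValue_le_age_add hμ hμ' hlam hβ hβ' s
    have h0 := mul_nonneg hβ.le (discValue_nonneg hμ hμ' hlam hβ freshState)
    obtain ⟨f, hf⟩ := exists_isDiscountOptimal hμ hμ' hlam hβ hβ'
    have h2 := hf.discValue_eq hμ hμ' hlam hβ hβ' s
    rw [discBellman] at h2
    have h3 := expect_transition_mono hμ.le hμ' s (f s) (discValue_nonneg hμ hμ' hlam hβ)
    rw [expect_transition_const] at h3
    have h4 := mul_nonneg hβ.le h3
    have h5 := age_le_cost hlam s (f s)
    rw [abs_le]
    constructor <;> linarith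
  obtain ⟨ha, hz⟩ := monotone_of_optimality_equation (g := 0)
    (A := lam + β * discValue μ lam β freshState) hμ hμ' hβ.le hβ'.le hK (fun a z => by
      rw [zero_add, discValue_eq_min hμ hμ' hlam hβ hβ', discBellman, discBellman,
        expect_transition_mec, expect_transition_loc, cost, cost, min_comm, add_assoc _ lam,
        min_add_add_left])
  exact apply_freshState_le (fun a z => by linarith [ha a z]) hz s

end Discount

/-! ### The limit of discount factors tending to one -/

section VanishingDiscount

variable {μ lam β : ℝ}

/-- The discounted value function relative to its value in the fresh state. -/
noncomputable def relValue (μ lam β : ℝ) (s : State) : ℝ := discValue μ lam β s - discValue μ lam β freshState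

lemma relValue_mem_Icc (hμ : 0 < μ) (hμ' : μ ≤ 1) (hlam : 0 ≤ lam) (hβ : 0 < β) (hβ' : β < 1)
    (s : State) : relValue μ lam β s ∈ Set.Icc 0 (((s.1 : ℕ) : ℝ) + 1 / 2 + lam) := by
  have h1 := discValue_le_age_add hμ hμ' hlam hβ hβ' s
  have h2 := discValue_freshState_le hμ hμ' hlam hβ hβ' s
  have h3 := discValue_nonneg hμ hμ' hlam hβ freshState
  constructor <;> rw [relValue] <;> nlinarith

lemma one_sub_mul_discValue_mem_Icc (hμ : 0 < μ) (hμ' : μ ≤ 1) (hlam : 0 ≤ lam) (hβ : 0 < β)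
    (hβ' : β < 1) : (1 - β) * discValue μ lam β freshState ∈ Set.Icc 0 (1 + 1 / 2 + lam) := by
  have h1 := discValue_le_age_add hμ hμ' hlam hβ hβ' freshState
  have h3 := discValue_nonneg hμ hμ' hlam hβ freshState
  have h4 : ((freshState.1 : ℕ) : ℝ) = 1 := by simp [freshState]
  rw [h4] at h1
  exact ⟨mul_nonneg (by linarith) h3, by linarith⟩

lemma discBellman_discValue (s : State) (u : Action) :
    discBellman μ lam β (discValue μ lam β) s u =
      discBellman μ lam β (relValue μ lam β) s u + β * discValue μ lam β freshState := by
  have : discValue μ lam β = fun t => relValue μ lam β t + discValue μ lam β freshState := by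
    funext t; rw [relValue]; ring
  rw [discBellman, discBellman]
  nth_rewrite 1 [this]
  rw [expect_add, expect_transition_const]
  ring

lemma relValue_eq_min (hμ : 0 < μ) (hμ' : μ ≤ 1) (hlam : 0 ≤ lam) (hβ : 0 < β) (hβ' : β < 1)
    (s : State) : (1 - β) * discValue μ lam β freshState + relValue μ lam β s =
      min (discBellman μ lam β (relValue μ lam β) s Action.loc)
        (discBellman μ lam β (relValue μ lam β) s Action.mec) := by
  have h := discValue_eq_min hμ hμ' hlam hβ hβ' s
  rw [discBellman_discValue, discBellman_discValue, min_add_add_right] at h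
  rw [relValue]
  linarith

lemma IsDiscountOptimal.relValue_eq {f : Rule} (hf : IsDiscountOptimal μ lam β f) (hμ : 0 < μ)
    (hμ' : μ ≤ 1) (hlam : 0 ≤ lam) (hβ : 0 < β) (hβ' : β < 1) (s : State) :
    (1 - β) * discValue μ lam β freshState + relValue μ lam β s =
      discBellman μ lam β (relValue μ lam β) s (f s) := by
  have h := hf.discValue_eq hμ hμ' hlam hβ hβ' s
  rw [discBellman_discValue] at h
  rw [relValue]
  linarith

lemma tendsto_discBellman {ι : Type*} {l : Filter ι} {β : ι → ℝ} {v : ι → State → ℝ}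
    {h : State → ℝ} (hβ : Filter.Tendsto β l (nhds 1))
    (hv : ∀ s, Filter.Tendsto (fun k => v k s) l (nhds (h s))) (s : State) (u : Action) :
    Filter.Tendsto (fun k => discBellman μ lam (β k) (v k) s u) l
      (nhds (bellman μ lam h s u)) := by
  have hE : Filter.Tendsto (fun k => expect (transition μ s u) (v k)) l
      (nhds (expect (transition μ s u) h)) := by
    simp only [expect, Finsupp.sum]
    exact tendsto_finsetSum _ fun t _ => (hv t).const_mul _
  have := (hβ.mul hE).const_add (cost lam s u)
  rwa [one_mul] at this

lemma IsVanishingDiscountLimit.exists_solvesOptimalityEquation (hμ : 0 < μ) (hμ' : μ ≤ 1)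
    (hlam : 0 ≤ lam) {f : Rule} (hf : IsVanishingDiscountLimit μ lam f) :
    ∃ (g : ℝ) (h : State → ℝ), SolvesOptimalityEquation μ lam g h f := by
  obtain ⟨β, F, hβ, hlim, hF, hFf⟩ := hf
  -- A nonprincipal ultrafilter yields limits at all states simultaneously, replacing a diagonal
  -- subsequence; eventual equality of the rules persists along it.
  have hU : ((Filter.hyperfilter ℕ : Ultrafilter ℕ) : Filter ℕ) ≤ Filter.atTop :=
    Nat.hyperfilter_le_atTop
  have key : ∀ (x : ℕ → ℝ) (b c : ℝ), (∀ k, x k ∈ Set.Icc b c) →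
      ∃ y ∈ Set.Icc b c, Filter.Tendsto x (Filter.hyperfilter ℕ) (nhds y) := by
    intro x b c hx
    obtain ⟨y, hy, hxy⟩ := (isCompact_Icc (a := b) (b := c)).ultrafilter_le_nhds
      ((Filter.hyperfilter ℕ).map x) (by
        rw [Filter.le_principal_iff]
        exact Filter.mem_map.2 (Filter.univ_mem' hx))
    exact ⟨y, hy, hxy⟩
  obtain ⟨g, -, hg⟩ := key (fun k => (1 - β k) * discValue μ lam (β k) freshState) _ _
    fun k => one_sub_mul_discValue_mem_Icc hμ hμ' hlam (hβ k).1 (hβ k).2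
  choose h hh0 hh using fun s => key (fun k => relValue μ lam (β k) s) _ _
    fun k => relValue_mem_Icc hμ hμ' hlam (hβ k).1 (hβ k).2 s
  have hbel := tendsto_discBellman (μ := μ) (lam := lam) (hlim.mono_left hU) hh
  refine ⟨g, h, ⟨0, fun s => by simpa using (hh0 s).1⟩, fun s => ?_, fun s => ?_⟩
  · refine tendsto_nhds_unique (hg.add (hh s)) ?_
    simp only [relValue_eq_min hμ hμ' hlam (hβ _).1 (hβ _).2]
    exact (hbel s _).min (hbel s _)
  · refine tendsto_nhds_unique (hg.add (hh s)) ((hbel s (f s)).congr' ?_)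
    filter_upwards [hU (hFf s)] with k hk
    rw [(hF k).relValue_eq hμ hμ' hlam (hβ k).1 (hβ k).2 s, hk]

/-- A sequence of rules has a pointwise convergent subsequence. -/
lemma exists_subseq_eventually_eq (F : ℕ → Rule) :
    ∃ (f : Rule) (φ : ℕ → ℕ), StrictMono φ ∧ ∀ s, ∀ᶠ k in Filter.atTop, F (φ k) s = f s := by
  let toBool : Action → Bool := fun u => Action.casesOn u false true
  let ofBool : Bool → Action := fun b => cond b Action.mec Action.loc
  have hinv : ∀ u, ofBool (toBool u) = u := fun u => by cases u <;> rfl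
  -- `State → Bool` is compact, and first countable because `State` is countable.
  obtain ⟨b, φ, hφ, hb⟩ := CompactSpace.tendsto_subseq fun k s => toBool (F k s)
  refine ⟨fun s => ofBool (b s), φ, hφ, fun s => ?_⟩
  have hs := (tendsto_pi_nhds.1 hb) s
  rw [nhds_discrete, Filter.tendsto_pure] at hs
  filter_upwards [hs] with k hk
  rw [← hk]
  exact (hinv _).symm

lemma exists_isVanishingDiscountLimit (hμ : 0 < μ) (hμ' : μ ≤ 1) (hlam : 0 ≤ lam) :
    ∃ f, IsVanishingDiscountLimit μ lam f := by
  -- The shift by 2 keeps the factor positive at `k = 0`.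
  have hβ : ∀ k : ℕ, 0 < 1 - 1 / ((k : ℝ) + 2) ∧ 1 - 1 / ((k : ℝ) + 2) < 1 := by
    intro k
    have hk : (0 : ℝ) < (k : ℝ) + 2 := by positivity
    have h1 : 0 < 1 / ((k : ℝ) + 2) := by positivity
    have h2 : 1 / ((k : ℝ) + 2) < 1 := by
      rw [div_lt_one hk]; linarith [Nat.cast_nonneg (α := ℝ) k]
    constructor <;> linarith
  have hlim : Filter.Tendsto (fun k : ℕ => 1 - 1 / ((k : ℝ) + 2)) Filter.atTop (nhds 1) := by
    have h : Filter.Tendsto (fun k : ℕ => 1 / ((k : ℝ) + 2)) Filter.atTop (nhds 0) :=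
      tendsto_const_nhds.div_atTop
        (Filter.tendsto_atTop_add_const_right _ _ tendsto_natCast_atTop_atTop)
    simpa using h.const_sub 1
  choose F hF using fun k => exists_isDiscountOptimal hμ hμ' hlam (hβ k).1 (hβ k).2
  obtain ⟨f, φ, hφ, hf⟩ := exists_subseq_eventually_eq F
  exact ⟨f, fun k => 1 - 1 / (((φ k : ℕ) : ℝ) + 2), fun k => F (φ k), fun k => hβ (φ k),
    hlim.comp hφ.tendsto_atTop, fun k => hF (φ k), hf⟩

end VanishingDiscount

end MECOffload

theorem lemma1 (μ lam : ℝ) (hμ : 0 < μ) (hμ' : μ ≤ 1) (hlam : 0 < lam) :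
    -- limits of discount-optimal stationary policies exist
    (∃ f : MECOffload.Rule, MECOffload.IsVanishingDiscountLimit μ lam f) ∧
    -- and they satisfy the average cost optimality equation
    (∀ f : MECOffload.Rule, MECOffload.IsVanishingDiscountLimit μ lam f →
      ∃ (g : ℝ) (h : MECOffload.State → ℝ),
        MECOffload.SolvesOptimalityEquation μ lam g h f) ∧
    -- every policy that satisfies this equation is optimal and monotone in `z`
    (∀ (f : MECOffload.Rule) (g : ℝ) (h : MECOffload.State → ℝ),
      MECOffload.SolvesOptimalityEquation μ lam g h f →
        (∀ s, MECOffload.avgCost μ lam (MECOffload.stationary f) s = (g : EReal)) ∧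
        MECOffload.IsAverageOptimal μ lam f ∧
        (∀ (a : ℕ+) (z : ℕ), f (a, z) = MECOffload.Action.mec →
          f (a, z + 1) = MECOffload.Action.mec) ∧
        (∀ (a : ℕ+) (z : ℕ), 1 ≤ z → f (a, z) = MECOffload.Action.loc →
          f (a, z - 1) = MECOffload.Action.loc) ∧
        Antitone (MECOffload.ageThreshold f)) := by
  refine ⟨MECOffload.exists_isVanishingDiscountLimit hμ hμ' hlam.le,
    fun f hf => hf.exists_solvesOptimalityEquation hμ hμ' hlam.le, fun f g h H => ?_⟩
  have hmec := H.mec_succ hμ hμ'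
  refine ⟨fun s => le_antisymm (H.avgCost_stationary_le hμ hμ' s) (H.le_avgCost hμ hμ' _ s),
    fun π s => (H.avgCost_stationary_le hμ hμ' s).trans (H.le_avgCost hμ hμ' π s), hmec,
    fun a z hz hf => ?_, MECOffload.antitone_ageThreshold hmec⟩
  obtain ⟨z, rfl⟩ := Nat.exists_eq_add_of_le' hz
  rw [Nat.add_sub_cancel]
  cases hf' : f (a, z) with
  | loc => rfl
  | mec => exact absurd ((hmec a z hf').symm.trans hf) (by simp)
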